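/- For real weights $n_{AB}>0$, $n_{BA}>0$, $n_{\overline{AB}}>0$ (the total weights of the rankings that put $A$ before $B$, that put $B$ before $A$, and that leave $A,B$ unordered), let $\Delta=\{X=(x_{AB},x_{BA}) : x_{AB}\ge 0,\ x_{BA}\ge 0,\ x_{AB}+x_{BA}\le 1\}$ and define the certainty $$C^+_{AB}=\frac12\int_\Delta\left|\frac{x_{AB}^{n_{AB}}\,x_{BA}^{n_{BA}}\,(1-x_{AB}-x_{BA})^{n_{\overline{AB}}}}{\int_\Delta y_{AB}^{n_{AB}}\,y_{BA}^{n_{BA}}\,(1-y_{AB}-y_{BA})^{n_{\overline{AB}}}\,\mathrm dY}-1\right|\mathrm dX ,$$ half the integrated deviation of the posterior density from the constant prior density $1$. Here $\mathrm dX$ is either the area element $\mathrm dx_{AB}\,\mathrm dx_{BA}$ on $\Delta$ or the uniform probability distribution on $\Delta$ (the area element divided by the area of $\Delta$), with the same choice in both integrals; the assertions below hold for each of the two choices. Let the conflict be $c_{AB}=\min\left\{\frac{n_{AB}}{n_{AB}+n_{BA}},\frac{n_{BA}}{n_{AB}+n_{BA}}\right\}$. Theorem 2. Fix $n_{\overline{AB}}>0$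 and the sum $N=n_{AB}+n_{BA}>0$. Then, as a function of $n_{AB}\in(0,N)$ with $n_{BA}=N-n_{AB}$, the certainty $C^+_{AB}$ is strictly decreasing on the range $n_{AB}\le n_{BA}$ and strictly increasing on the range $n_{AB}\ge n_{BA}$. In particular, among all $n_{AB},n_{BA}>0$ with sum $N$, the certainty is smallest exactly at $n_{AB}=n_{BA}=N/2$, which is also exactly where the conflict $c_{AB}$ is largest. -/

import Mathlib

open MeasureTheory

noncomputable section

/-- The parameter domain of `X = (x_AB, x_BA)`: both probabilities are nonnegative, and so is
`1 - x_AB - x_BA`, the probability of an unordered pair. -/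
def probSimplex : Set (ℝ × ℝ) :=
  {x | 0 ≤ x.1 ∧ 0 ≤ x.2 ∧ x.1 + x.2 ≤ 1}

/-- The area element `dX = dx_AB dx_BA` on the domain, without normalization. -/
def areaElement : Measure (ℝ × ℝ) :=
  volume.restrict probSimplex

/-- The uniform probability distribution on the domain: the area element divided by the total
area, so that the constant density `1` is a probability density. -/
def uniformElement : Measure (ℝ × ℝ) :=
  ProbabilityTheory.cond volume probSimplex

/-- The likelihood kernel `x_AB ^ n_AB * x_BA ^ n_BA * (1 - x_AB - x_BA) ^ n_U`; the weights are
real numbers, and `nU` is the total weight of the unordered rankings. -/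
def likelihoodKernel (nAB nBA nU : ℝ) (x : ℝ × ℝ) : ℝ :=
  x.1 ^ nAB * x.2 ^ nBA * (1 - x.1 - x.2) ^ nU

/-- The prior density: constant, equal to `1`. -/
def priorDensity (_x : ℝ × ℝ) : ℝ := 1

/-- The posterior density with respect to `dX = μ`, by Bayes' rule. -/
def posteriorDensity (μ : Measure (ℝ × ℝ)) (nAB nBA nU : ℝ) (x : ℝ × ℝ) : ℝ :=
  priorDensity x * likelihoodKernel nAB nBA nU x /
    ∫ y, priorDensity y * likelihoodKernel nAB nBA nU y ∂μ

/-- The certainty `C⁺_AB`: half the integrated absolute deviation of the posterior density from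
the prior density, where `dX = μ`. -/
def certainty (μ : Measure (ℝ × ℝ)) (nAB nBA nU : ℝ) : ℝ :=
  (1 / 2) * ∫ x, |posteriorDensity μ nAB nBA nU x - priorDensity x| ∂μ

/-- The conflict of the rankings. -/
def conflict (nAB nBA : ℝ) : ℝ :=
  min (nAB / (nAB + nBA)) (nBA / (nAB + nBA))

end

/-! Put `a = nAB`, `b = nBA`, `u = nU`, `p = a / N`, `s = x + y` and `t = x / (x + y)`. The area
element becomes `s ds dt`, and the kernel splits as `s ^ N * (1 - s) ^ u` times `exp (N * logBeta p
t)`. The first factor does not depend on `p`. Hence, for each `s`, the inner integral over `t` is a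
positive multiple of the L¹ distance on `(0, 1)` between a beta probability density with mode `p`
and a positive constant `c`, where `c` and the multiple depend on `s` but not on `p`. It suffices
that this distance grows with `p` on `[1/2, 1)` (`integral_abs_exp_logBeta_sub`); the other half
follows by exchanging the two coordinates.

The distance to a constant sees only the distribution of the values of the density, so `logBeta p`
may be replaced by its increasing rearrangement `ξ` (`exists_logBeta_rearrangement`). If `ξ' - ξ` is
strictly increasing for `p < p'`, the rearranged densities have a strictly increasing ratio. The one
for `p'` then has less mass below any cut and more above it; cutting where the density for `p`
equals `c` gives the inequality (`integral_abs_sub_lt`).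

There remains the slope of `ξ` at `k`. Let `(t, t + l)` with `l = 1 - k` be the superlevel interval
of `logBeta p` of length `l`. The slope is `1 / (l * (1 / F - 1))` with `F = (p - t) * (t + l - p) /
(p * (1 - p))`, so `F` has to increase with `p` at fixed `l` (`chord_product_lt`). With `t` as
parameter and `p = chordMode l t`, the logarithmic derivative of `F` is positive once `0 < 1 / (t +
l - p) - 1 / (p - t) < (2 * p - 1) / (p * (1 - p))`. These two bounds are the analytic core:
`sub_lt_sub_of_logBeta_eq` and `inv_sub_inv_lt_of_logBeta_eq`. -/

/-- A strictly monotone bijection between open sets of reals with nonvanishing derivative has a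
differentiable inverse. -/
theorem StrictMonoOn.exists_inverse_hasDerivAt {I J : Set ℝ} {f f' : ℝ → ℝ} (hI : IsOpen I)
    (hJ : IsOpen J) (mono : StrictMonoOn f I) (maps : Set.MapsTo f I J) (surj : Set.SurjOn f I J)
    (hd : ∀ x ∈ I, HasDerivAt f (f' x) x) (hne : ∀ x ∈ I, f' x ≠ 0) :
    ∃ g : ℝ → ℝ, Set.MapsTo g J I ∧ (∀ y ∈ J, f (g y) = y) ∧ (∀ x ∈ I, g (f x) = x) ∧
      StrictMonoOn g J ∧ ∀ y ∈ J, HasDerivAt g (f' (g y))⁻¹ y := by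
  have h : ∀ y, ∃ x, y ∈ J → x ∈ I ∧ f x = y := by
    intro y
    by_cases hy : y ∈ J
    · obtain ⟨x, hx, rfl⟩ := surj hy
      exact ⟨x, fun _ => ⟨hx, rfl⟩⟩
    · exact ⟨0, fun h => absurd h hy⟩
  choose g hg using h
  have gI : Set.MapsTo g J I := fun y hy => (hg y hy).1
  have fg : ∀ y ∈ J, f (g y) = y := fun y hy => (hg y hy).2
  have gf : ∀ x ∈ I, g (f x) = x := fun x hx =>
    mono.injOn (gI (maps hx)) hx (fg _ (maps hx))
  have gmono : StrictMonoOn g J := by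
    intro y hy z hz hyz
    rw [← mono.lt_iff_lt (gI hy) (gI hz), fg y hy, fg z hz]
    exact hyz
  refine ⟨g, gI, fg, gf, gmono, fun y hy => ?_⟩
  have himg : I ⊆ g '' J := fun x hx => ⟨f x, maps hx, gf x hx⟩
  have hc : ContinuousAt g y := gmono.continuousAt_of_image_mem_nhds (hJ.mem_nhds hy)
    (Filter.mem_of_superset (hI.mem_nhds (gI hy)) himg)
  exact HasDerivAt.of_local_left_inverse hc (hd _ (gI hy)) (hne _ (gI hy))
    (Filter.mem_of_superset (hJ.mem_nhds hy) fg)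

/-! ### The log-beta function and its two monotone branches -/

/-- The logarithm of `t ^ p * (1 - t) ^ (1 - p)`. -/
noncomputable def logBeta (p t : ℝ) : ℝ := p * Real.log t + (1 - p) * Real.log (1 - t)

theorem logBeta_symm (p t : ℝ) : logBeta (1 - p) (1 - t) = logBeta p t := by
  simp only [logBeta, sub_sub_cancel]; ring

theorem hasDerivAt_logBeta (p : ℝ) {t : ℝ} (h0 : 0 < t) (h1 : t < 1) :
    HasDerivAt (logBeta p) ((p - t) / (t * (1 - t))) t := by
  have h2 : (1 - t) ≠ 0 := by linarith
  have a := ((Real.hasDerivAt_log h0.ne').const_mul p).add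
    ((((hasDerivAt_id t).const_sub 1).log h2).const_mul (1 - p))
  refine HasDerivAt.congr_deriv a ?_
  simp only [id]
  field_simp
  ring

theorem continuousOn_logBeta (p : ℝ) : ContinuousOn (logBeta p) (Set.Ioo 0 1) :=
  fun _ ht => (hasDerivAt_logBeta p ht.1 ht.2).continuousAt.continuousWithinAt

theorem measurable_logBeta (p : ℝ) : Measurable (logBeta p) := by
  unfold logBeta; fun_prop

theorem strictMonoOn_logBeta {p : ℝ} (h1 : p < 1) :
    StrictMonoOn (logBeta p) (Set.Ioc 0 p) := by
  refine strictMonoOn_of_deriv_pos (convex_Ioc 0 p)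
    ((continuousOn_logBeta p).mono fun t ht => ⟨ht.1, ht.2.trans_lt h1⟩) fun t ht => ?_
  rw [interior_Ioc] at ht
  have : 0 < 1 - t := by linarith [ht.2]
  rw [(hasDerivAt_logBeta p ht.1 (ht.2.trans h1)).deriv]
  exact div_pos (sub_pos.2 ht.2) (mul_pos ht.1 this)

theorem strictAntiOn_logBeta {p : ℝ} (h0 : 0 < p) :
    StrictAntiOn (logBeta p) (Set.Ico p 1) := by
  intro x hx y hy hxy
  rw [← logBeta_symm p x, ← logBeta_symm p y]
  refine strictMonoOn_logBeta (by linarith) ⟨?_, ?_⟩ ⟨?_, ?_⟩ ?_ <;> linarith [hx.1, hx.2, hy.1, hy.2]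

theorem logBeta_lt_max {p t : ℝ} (h0 : 0 < p) (h1 : p < 1) (t0 : 0 < t) (t1 : t < 1)
    (ht : t ≠ p) : logBeta p t < logBeta p p := by
  rcases ht.lt_or_gt with h | h
  · exact strictMonoOn_logBeta h1 ⟨t0, h.le⟩ ⟨h0, le_rfl⟩ h
  · exact strictAntiOn_logBeta h0 ⟨le_rfl, h1⟩ ⟨h.le, t1⟩ h

theorem logBeta_le_max {p t : ℝ} (h0 : 0 < p) (h1 : p < 1) (t0 : 0 < t) (t1 : t < 1) :
    logBeta p t ≤ logBeta p p := by
  rcases eq_or_ne t p with rfl | h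
  · exact le_rfl
  · exact (logBeta_lt_max h0 h1 t0 t1 h).le

theorem surjOn_logBeta {p : ℝ} (h0 : 0 < p) (h1 : p < 1) :
    Set.SurjOn (logBeta p) (Set.Ioo 0 p) (Set.Iio (logBeta p p)) := by
  intro u hu
  have hu : u < logBeta p p := hu
  -- Chosen so that `p * log t = u`. The other summand of `logBeta p t` is nonpositive, so this
  -- point lies at or below level `u`.
  set t := Real.exp (u / p) with ht
  have t0 : 0 < t := Real.exp_pos _
  have hlt : t < p := by
    rw [ht, ← Real.lt_log_iff_exp_lt h0, div_lt_iff₀ h0]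
    have : (1 - p) * Real.log (1 - p) < 0 :=
      mul_neg_of_pos_of_neg (by linarith) (Real.log_neg (by linarith) (by linarith))
    unfold logBeta at hu
    linarith
  have hle : logBeta p t ≤ u := by
    have : (1 - p) * Real.log (1 - t) ≤ 0 :=
      mul_nonpos_of_nonneg_of_nonpos (by linarith) (Real.log_nonpos (by linarith) (by linarith))
    have h3 : p * Real.log t = u := by rw [ht, Real.log_exp]; field_simp
    unfold logBeta
    linarith
  have hc : ContinuousOn (logBeta p) (Set.Icc t p) :=
    (continuousOn_logBeta p).mono fun x hx => ⟨t0.trans_le hx.1, hx.2.trans_lt h1⟩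
  obtain ⟨x, hx, rfl⟩ := intermediate_value_Ico hlt.le hc ⟨hle, hu⟩
  exact ⟨x, ⟨t0.trans_le hx.1, hx.2⟩, rfl⟩

/-- The inverse of `logBeta p` on the increasing branch `(0, p)`. -/
theorem exists_leftBranch {p : ℝ} (h0 : 0 < p) (h1 : p < 1) :
    ∃ g : ℝ → ℝ, Set.MapsTo g (Set.Iio (logBeta p p)) (Set.Ioo 0 p) ∧
      (∀ u ∈ Set.Iio (logBeta p p), logBeta p (g u) = u) ∧
      (∀ t ∈ Set.Ioo 0 p, g (logBeta p t) = t) ∧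
      StrictMonoOn g (Set.Iio (logBeta p p)) ∧
      ∀ u ∈ Set.Iio (logBeta p p), HasDerivAt g (g u * (1 - g u) / (p - g u)) u := by
  have key := StrictMonoOn.exists_inverse_hasDerivAt (f := logBeta p)
    (f' := fun t => (p - t) / (t * (1 - t))) isOpen_Ioo isOpen_Iio
    ((strictMonoOn_logBeta h1).mono Set.Ioo_subset_Ioc_self)
    (fun t ht => logBeta_lt_max h0 h1 ht.1 (ht.2.trans h1) ht.2.ne) (surjOn_logBeta h0 h1)
    (fun t ht => hasDerivAt_logBeta p ht.1 (ht.2.trans h1))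
    (fun t ht => ne_of_gt (div_pos (sub_pos.2 ht.2) (mul_pos ht.1 (by linarith [ht.2]))))
  simpa only [inv_div] using key

/-! ### Asymmetry of a superlevel interval about its mode -/

/-- To the right of a mode `p > 1 / 2`, `logBeta p` falls faster than to the left. -/
theorem logBeta_reflect_lt {p e : ℝ} (hp : 1 / 2 < p) (e0 : 0 < e) (e1 : e < 1 - p) :
    logBeta p (p + e) < logBeta p (p - e) := by
  have key : StrictMonoOn (fun x => logBeta p (p - x) - logBeta p (p + x)) (Set.Ico 0 (1 - p)) := by
    have hd : ∀ x ∈ Set.Ico 0 (1 - p), HasDerivAt (fun x => logBeta p (p - x) - logBeta p (p + x))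
        (-(x / ((p - x) * (1 - (p - x)))) + x / ((p + x) * (1 - (p + x)))) x := by
      intro x hx
      have a := (hasDerivAt_logBeta p (t := p - x) (by linarith [hx.2]) (by linarith [hx.1])).comp x
        ((hasDerivAt_id x).const_sub p)
      have b := (hasDerivAt_logBeta p (t := p + x) (by linarith [hx.1]) (by linarith [hx.2])).comp x
        ((hasDerivAt_id x).const_add p)
      refine HasDerivAt.congr_deriv (a.sub b) ?_
      ring
    refine strictMonoOn_of_deriv_pos (convex_Ico _ _)
      (fun x hx => (hd x hx).continuousAt.continuousWithinAt) fun x hx => ?_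
    rw [interior_Ico] at hx
    rw [(hd x ⟨hx.1.le, hx.2⟩).deriv]
    have h1 : 0 < (p + x) * (1 - (p + x)) := mul_pos (by linarith [hx.1]) (by linarith [hx.2])
    -- The difference of the two sides is `2 * x * (2 * p - 1)`: the point `p + x` is farther from
    -- `1 / 2` than `p - x`.
    have h2 : (p + x) * (1 - (p + x)) < (p - x) * (1 - (p - x)) := by nlinarith [hx.1]
    have := div_lt_div_of_pos_left hx.1 h1 h2
    linarith
  have := key ⟨le_rfl, by linarith⟩ ⟨e0.le, e1⟩ e0
  simp only [sub_zero, add_zero, sub_self] at this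
  linarith

/-- The expression is `logBeta p (p + w) - logBeta p t₀`, where `t₀ < p` is the point with `1 / w -
1 / (p - t₀) = (2 * p - 1) / (p * (1 - p))`. It vanishes at `w = 0`, and it increases because `(p +
w) * (1 - p - w)` falls short of `p * (1 - p) - (2 * p - 1) * w` by exactly `w ^ 2`. -/
theorem log_deviation_pos {p w : ℝ} (hp : 1 / 2 < p) (w0 : 0 < w) (w1 : w < 1 - p) :
    0 < (2 * p - 1) * (Real.log (p + w) - Real.log p - Real.log (1 - p - w) + Real.log (1 - p)) +
      Real.log (p * (1 - p) - (2 * p - 1) * w) - Real.log (p * (1 - p)) := by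
  set G : ℝ → ℝ := fun w => (2 * p - 1) *
    (Real.log (p + w) - Real.log p - Real.log (1 - p - w) + Real.log (1 - p)) +
      Real.log (p * (1 - p) - (2 * p - 1) * w) - Real.log (p * (1 - p)) with hG
  have key : StrictMonoOn G (Set.Ico 0 (1 - p)) := by
    have pos : ∀ x ∈ Set.Ico 0 (1 - p), 0 < p * (1 - p) - (2 * p - 1) * x := by
      intro x hx
      nlinarith [mul_pos (show 0 < p + x by linarith [hx.1]) (show 0 < 1 - p - x by linarith [hx.2]),
        sq_nonneg x]
    have hd : ∀ x ∈ Set.Ico 0 (1 - p), HasDerivAt G ((2 * p - 1) * (1 / (p + x) + 1 / (1 - p - x)) -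
        (2 * p - 1) / (p * (1 - p) - (2 * p - 1) * x)) x := by
      intro x hx
      have a := ((hasDerivAt_id x).const_add p).log (show p + x ≠ 0 by linarith [hx.1])
      have b := ((hasDerivAt_id x).const_sub (1 - p)).log
        (show 1 - p - x ≠ 0 by linarith [hx.2])
      have c := (((hasDerivAt_id x).const_mul (2 * p - 1)).const_sub (p * (1 - p))).log
        (pos x hx).ne'
      have := ((((((a.sub_const (Real.log p)).sub b).add_const (Real.log (1 - p))).const_mul
        (2 * p - 1)).add c).sub_const (Real.log (p * (1 - p))))
      refine HasDerivAt.congr_deriv this ?_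
      simp only [id]
      ring
    refine strictMonoOn_of_deriv_pos (convex_Ico _ _)
      (fun x hx => (hd x hx).continuousAt.continuousWithinAt) fun x hx => ?_
    rw [interior_Ico] at hx
    rw [(hd x ⟨hx.1.le, hx.2⟩).deriv]
    have h1 : 0 < p + x := by linarith [hx.1]
    have h2 : 0 < 1 - p - x := by linarith [hx.2]
    have h3 : 1 / (p + x) + 1 / (1 - p - x) = 1 / ((p + x) * (1 - p - x)) := by
      field_simp; ring
    have h4 : 1 / (p * (1 - p) - (2 * p - 1) * x) < 1 / ((p + x) * (1 - p - x)) :=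
      one_div_lt_one_div_of_lt (mul_pos h1 h2) (by nlinarith [hx.1, sq_pos_of_pos hx.1])
    rw [h3, sub_pos, ← mul_one_div (2 * p - 1) (p * (1 - p) - _)]
    exact mul_lt_mul_of_pos_left h4 (by linarith)
  have := key ⟨le_rfl, by linarith⟩ ⟨w0.le, w1⟩ w0
  simp only [hG, sub_zero, add_zero, mul_zero, sub_self] at this
  linarith

/-- For two points `t < p < s` at the same level of `logBeta p`, where `1 / 2 < p`, the left one is
farther from the mode. -/
theorem sub_lt_sub_of_logBeta_eq {p t s : ℝ} (hp : 1 / 2 < p) (t0 : 0 < t) (htp : t < p)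
    (hps : p < s) (s1 : s < 1) (h : logBeta p t = logBeta p s) : s - p < p - t := by
  by_contra! hc
  have h1 := logBeta_reflect_lt hp (sub_pos.2 hps) (by linarith)
  have h2 : logBeta p (p - (s - p)) ≤ logBeta p t :=
    (strictMonoOn_logBeta (by linarith)).monotoneOn ⟨by linarith, by linarith⟩ ⟨t0, htp.le⟩
      (by linarith)
  rw [add_sub_cancel] at h1
  linarith

/-- Equality would hold at `t₀ = p - p * (1 - p) * w / d`. If the bound failed, `t` would lie at or
left of `t₀`, hence at a level at most `logBeta p t₀`, which by `log_deviation_pos` is below the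
level of `s`. -/
theorem inv_sub_inv_lt_of_logBeta_eq {p t s : ℝ} (hp : 1 / 2 < p) (t0 : 0 < t) (htp : t < p)
    (hps : p < s) (s1 : s < 1) (h : logBeta p t = logBeta p s) :
    1 / (s - p) - 1 / (p - t) < (2 * p - 1) / (p * (1 - p)) := by
  set w := s - p with hw
  have w0 : 0 < w := sub_pos.2 hps
  have q0 : 0 < 1 - p := by linarith
  have hden : 0 < p * (1 - p) - (2 * p - 1) * w := by
    nlinarith [mul_pos (show 0 < p + w by linarith) (show 0 < 1 - p - w by linarith), sq_nonneg w]
  have p0 : 0 < p := by linarith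
  by_contra! hc
  set d := p * (1 - p) - (2 * p - 1) * w with hd
  have e0 : 0 < p - t := by linarith
  have hle : p * (1 - p) * w / d ≤ p - t := by
    rw [div_le_iff₀ hden]
    rw [div_sub_div _ _ w0.ne' e0.ne', div_le_div_iff₀ (mul_pos p0 q0) (mul_pos w0 e0)] at hc
    rw [hd]; nlinarith
  -- The extremal point and its complement factor completely, so `logBeta p` there expands into the
  -- logarithms of `log_deviation_pos`.
  have e1 : p - p * (1 - p) * w / d = p ^ 2 * (1 - p - w) / d := by
    field_simp; rw [hd]; ring
  have e2 : 1 - p ^ 2 * (1 - p - w) / d = (1 - p) ^ 2 * (p + w) / d := by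
    field_simp; rw [hd]; ring
  have qw : 0 < 1 - p - w := by linarith
  have pw : 0 < p + w := by linarith
  have hlow : logBeta p t ≤ logBeta p (p ^ 2 * (1 - p - w) / d) := by
    refine (strictMonoOn_logBeta (by linarith)).monotoneOn ⟨t0, htp.le⟩ ⟨by positivity, ?_⟩ ?_
    · rw [← e1]
      have : 0 < p * (1 - p) * w / d := by positivity
      linarith
    · rw [← e1]; linarith
  have hpos := log_deviation_pos hp w0 (by linarith)
  have hs : logBeta p s = p * Real.log (p + w) + (1 - p) * Real.log (1 - p - w) := by
    unfold logBeta; rw [hw]; congr 3 <;> ring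
  have ht : logBeta p (p ^ 2 * (1 - p - w) / d) =
      p * (2 * Real.log p + Real.log (1 - p - w) - Real.log d) +
      (1 - p) * (2 * Real.log (1 - p) + Real.log (p + w) - Real.log d) := by
    unfold logBeta
    rw [e2, Real.log_div (by positivity) hden.ne', Real.log_div (by positivity) hden.ne',
      Real.log_mul (by positivity) qw.ne', Real.log_mul (by positivity) pw.ne', Real.log_pow,
      Real.log_pow]
    push_cast; ring
  rw [Real.log_mul p0.ne' q0.ne'] at hpos
  rw [ht, h, hs] at hlow
  linarith

/-! ### Chords of fixed length, parametrized by the left endpoint -/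

/-- The parameter `p` for which `logBeta p` takes equal values at `t` and `t + l`. -/
noncomputable def chordMode (l t : ℝ) : ℝ :=
  (Real.log (1 - t) - Real.log (1 - t - l)) /
    (Real.log (t + l) - Real.log t + (Real.log (1 - t) - Real.log (1 - t - l)))

section
variable {l t : ℝ}

theorem chord_logs_pos (hl : 0 < l) (t0 : 0 < t) (t1 : t < 1 - l) :
    0 < Real.log (t + l) - Real.log t ∧ 0 < Real.log (1 - t) - Real.log (1 - t - l) :=
  ⟨sub_pos.2 (Real.log_lt_log t0 (by linarith)),
    sub_pos.2 (Real.log_lt_log (by linarith) (by linarith))⟩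

theorem chordMode_eq {p : ℝ} (hl : 0 < l) (t0 : 0 < t) (t1 : t < 1 - l)
    (h : logBeta p t = logBeta p (t + l)) : chordMode l t = p := by
  obtain ⟨a, b⟩ := chord_logs_pos hl t0 t1
  rw [chordMode, div_eq_iff (by positivity)]
  unfold logBeta at h
  rw [show 1 - (t + l) = 1 - t - l by ring] at h
  linarith

theorem logBeta_chordMode (hl : 0 < l) (t0 : 0 < t) (t1 : t < 1 - l) :
    logBeta (chordMode l t) t = logBeta (chordMode l t) (t + l) := by
  obtain ⟨a, b⟩ := chord_logs_pos hl t0 t1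
  have : chordMode l t * (Real.log (t + l) - Real.log t +
    (Real.log (1 - t) - Real.log (1 - t - l))) = Real.log (1 - t) - Real.log (1 - t - l) := by
    rw [chordMode, div_mul_cancel₀]; positivity
  unfold logBeta
  rw [show 1 - (t + l) = 1 - t - l by ring]
  linarith

theorem chordMode_mem (hl : 0 < l) (t0 : 0 < t) (t1 : t < 1 - l) :
    chordMode l t ∈ Set.Ioo (0 : ℝ) 1 := by
  obtain ⟨a, b⟩ := chord_logs_pos hl t0 t1
  exact ⟨div_pos b (by positivity), (div_lt_one (by positivity)).2 (by linarith)⟩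

theorem chordMode_between (hl : 0 < l) (t0 : 0 < t) (t1 : t < 1 - l) :
    t < chordMode l t ∧ chordMode l t < t + l := by
  obtain ⟨p0, p1⟩ := chordMode_mem hl t0 t1
  have h := logBeta_chordMode hl t0 t1
  constructor
  · by_contra! hc
    exact absurd h (strictAntiOn_logBeta p0 ⟨hc, by linarith⟩ ⟨by linarith, by linarith⟩
      (by linarith : t < t + l)).ne'
  · by_contra! hc
    exact absurd h (strictMonoOn_logBeta p1 ⟨t0, by linarith⟩ ⟨by linarith, hc⟩
      (by linarith : t < t + l)).ne

/-- With `A = log (t + l) - log t` and `B = log (1 - t) - log (1 - t - l)`, the mode is `B / (A +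
B)`. Both are positive, `A` decreases and `B` increases. Only the sign of the derivative is needed
later. -/
theorem exists_hasDerivAt_chordMode (hl : 0 < l) (t0 : 0 < t) (t1 : t < 1 - l) :
    ∃ d, 0 < d ∧ HasDerivAt (chordMode l) d t := by
  obtain ⟨a, b⟩ := chord_logs_pos hl t0 t1
  have hA := (((hasDerivAt_id t).add_const l).log (show t + l ≠ 0 by linarith)).sub
    (Real.hasDerivAt_log t0.ne')
  have hB := (((hasDerivAt_id t).const_sub 1).log (show 1 - t ≠ 0 by linarith)).sub
    ((((hasDerivAt_id t).const_sub 1).sub_const l).log (show 1 - t - l ≠ 0 by linarith))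
  have hAB := hB.div (hA.add hB) (by simp only [Pi.add_apply, Pi.sub_apply, id]; positivity)
  refine ⟨_, ?_, hAB⟩
  simp only [Pi.add_apply, Pi.sub_apply, id]
  refine div_pos ?_ (by positivity)
  have dA : 1 / (t + l) - t⁻¹ < 0 := by
    rw [sub_neg, ← one_div]; exact one_div_lt_one_div_of_lt t0 (by linarith)
  have dB : 0 < -1 / (1 - t) - -1 / (1 - t - l) := by
    rw [neg_div, neg_div, sub_neg_eq_add, neg_add_eq_sub, sub_pos]
    exact one_div_lt_one_div_of_lt (by linarith) (by linarith)
  nlinarith [mul_pos dB a, mul_pos b (neg_pos.2 dA)]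

theorem strictMonoOn_chordMode (hl : 0 < l) : StrictMonoOn (chordMode l) (Set.Ioo 0 (1 - l)) := by
  refine strictMonoOn_of_deriv_pos (convex_Ioo _ _) (fun x hx => ?_) fun x hx => ?_
  · obtain ⟨d, -, hd⟩ := exists_hasDerivAt_chordMode hl hx.1 hx.2
    exact hd.continuousAt.continuousWithinAt
  · rw [interior_Ioo] at hx
    obtain ⟨d, d0, hd⟩ := exists_hasDerivAt_chordMode hl hx.1 hx.2
    rwa [hd.deriv]

theorem chordMode_mid (hl : 0 < l) (h1 : l < 1) : chordMode l ((1 - l) / 2) = 1 / 2 := by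
  apply chordMode_eq hl (by linarith) (by linarith)
  unfold logBeta
  rw [show 1 - ((1 - l) / 2) = (1 - l) / 2 + l by ring,
    show 1 - ((1 - l) / 2 + l) = (1 - l) / 2 by ring]
  ring

/-- The function is the logarithm of the normalized product in `chord_product_lt`. The range starts
at the centered chord, whose mode is `1 / 2`; in the interior the mode exceeds `1 / 2` and both
asymmetry bounds apply. -/
theorem strictMonoOn_chordRatio (hl : 0 < l) (h1 : l < 1) :
    StrictMonoOn (fun t => Real.log (chordMode l t - t) + Real.log (t + l - chordMode l t) -
      Real.log (chordMode l t) - Real.log (1 - chordMode l t)) (Set.Ico ((1 - l) / 2) (1 - l)) := by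
  have hd : ∀ t ∈ Set.Ico ((1 - l) / 2) (1 - l), ∃ d, 0 < d ∧ HasDerivAt
      (fun t => Real.log (chordMode l t - t) + Real.log (t + l - chordMode l t) -
      Real.log (chordMode l t) - Real.log (1 - chordMode l t))
      ((d - 1) / (chordMode l t - t) + (1 - d) / (t + l - chordMode l t) - d / chordMode l t -
        -d / (1 - chordMode l t)) t := by
    intro t ht
    have t0 : 0 < t := by linarith [ht.1]
    obtain ⟨d, d0, hd⟩ := exists_hasDerivAt_chordMode hl t0 ht.2
    obtain ⟨b1, b2⟩ := chordMode_between hl t0 ht.2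
    obtain ⟨p0, p1⟩ := chordMode_mem hl t0 ht.2
    refine ⟨d, d0, ?_⟩
    exact ((((hd.sub (hasDerivAt_id t)).log (sub_pos.2 b1).ne').add
      ((((hasDerivAt_id t).add_const l).sub hd).log (sub_pos.2 b2).ne')).sub (hd.log p0.ne')).sub
      ((hd.const_sub 1).log (sub_pos.2 p1).ne')
  refine strictMonoOn_of_deriv_pos (convex_Ico _ _) (fun x hx => ?_) fun x hx => ?_
  · obtain ⟨d, -, hd⟩ := hd x hx
    exact hd.continuousAt.continuousWithinAt
  · rw [interior_Ico] at hx
    obtain ⟨d, d0, hd⟩ := hd x ⟨hx.1.le, hx.2⟩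
    have x0 : 0 < x := by linarith [hx.1]
    rw [hd.deriv]
    obtain ⟨b1, b2⟩ := chordMode_between hl x0 hx.2
    obtain ⟨p0, p1⟩ := chordMode_mem hl x0 hx.2
    have hp : 1 / 2 < chordMode l x := by
      rw [← chordMode_mid hl h1]
      exact strictMonoOn_chordMode hl ⟨by linarith, by linarith⟩ ⟨x0, hx.2⟩ hx.1
    have h := logBeta_chordMode hl x0 hx.2
    have i1 := sub_lt_sub_of_logBeta_eq hp x0 b1 b2 (by linarith [hx.2]) h
    have i2 := inv_sub_inv_lt_of_logBeta_eq hp x0 b1 b2 (by linarith [hx.2]) h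
    set p := chordMode l x
    have i3 := one_div_lt_one_div_of_lt (sub_pos.2 b2) i1
    have q0 : 0 < 1 - p := by linarith
    -- Collecting the terms in `d`, the derivative of the mode, leaves a combination in which each
    -- of the two bounds makes one summand positive.
    have e : (d - 1) / (p - x) + (1 - d) / (x + l - p) - d / p - -d / (1 - p) =
      d * ((2 * p - 1) / (p * (1 - p)) - (1 / (x + l - p) - 1 / (p - x))) +
        (1 / (x + l - p) - 1 / (p - x)) := by
      have : (2 * p - 1) / (p * (1 - p)) = 1 / (1 - p) - 1 / p := by field_simp; ring
      rw [this]; ring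
    rw [e]
    have := mul_pos d0 (sub_pos.2 i2)
    linarith

end

/-- At a fixed length of the superlevel interval, the normalized product of the distances of its
endpoints from the mode increases with the mode. -/
theorem chord_product_lt {l p p' t t' : ℝ} (hl : 0 < l) (h1 : l < 1) (hp : 1 / 2 ≤ p)
    (hpp : p < p') (t0 : 0 < t) (t1 : t < 1 - l) (t0' : 0 < t') (t1' : t' < 1 - l)
    (h : logBeta p t = logBeta p (t + l)) (h' : logBeta p' t' = logBeta p' (t' + l)) :
    (p - t) * (t + l - p) / (p * (1 - p)) < (p' - t') * (t' + l - p') / (p' * (1 - p')) := by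
  have ep := chordMode_eq hl t0 t1 h
  have ep' := chordMode_eq hl t0' t1' h'
  have htt : t < t' := by
    rwa [← (strictMonoOn_chordMode hl).lt_iff_lt ⟨t0, t1⟩ ⟨t0', t1'⟩, ep, ep']
  have hm : (1 - l) / 2 ≤ t := by
    rwa [← (strictMonoOn_chordMode hl).le_iff_le ⟨by linarith, by linarith⟩ ⟨t0, t1⟩, ep,
      chordMode_mid hl h1]
  have := strictMonoOn_chordRatio hl h1 ⟨hm, t1⟩ ⟨by linarith, t1'⟩ htt
  obtain ⟨b1, b2⟩ := chordMode_between hl t0 t1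
  obtain ⟨b1', b2'⟩ := chordMode_between hl t0' t1'
  obtain ⟨p0, p1⟩ := chordMode_mem hl t0 t1
  obtain ⟨p0', p1'⟩ := chordMode_mem hl t0' t1'
  simp only [ep, ep'] at *
  have a1 := sub_pos.2 b1
  have a2 := sub_pos.2 b2
  have a3 := sub_pos.2 p1
  have a1' := sub_pos.2 b1'
  have a2' := sub_pos.2 b2'
  have a3' := sub_pos.2 p1'
  rw [← Real.log_lt_log_iff (by positivity) (by positivity),
    Real.log_div (by positivity) (by positivity), Real.log_div (by positivity) (by positivity),
    Real.log_mul a1.ne' a2.ne', Real.log_mul a1'.ne' a2'.ne', Real.log_mul p0.ne' a3.ne',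
    Real.log_mul p0'.ne' a3'.ne']
  linarith

/-! ### Increasing rearrangements and comparison of their slopes -/

/-- The increasing rearrangement of `logBeta p` on `(0, 1)`, with its derivative expressed through
the endpoints of the superlevel interval of length `1 - k`. -/
theorem exists_logBeta_rearrangement {p : ℝ} (h0 : 0 < p) (h1 : p < 1) :
    ∃ ξ : ℝ → ℝ, StrictMonoOn ξ (Set.Ioo 0 1) ∧
      (∀ k ∈ Set.Ioo (0 : ℝ) 1, ∃ t, 0 < t ∧ t < k ∧ t < p ∧ p < t + (1 - k) ∧
        logBeta p t = ξ k ∧ logBeta p (t + (1 - k)) = ξ k ∧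
        HasDerivAt ξ ((1 - k) *
          ((p - t) * (t + (1 - k) - p) / (p * (1 - p)))⁻¹ - (1 - k))⁻¹ k) ∧
      (∀ u < logBeta p p, ∃ k ∈ Set.Ioo (0 : ℝ) 1, ξ k = u) ∧
      Measure.map (logBeta p) (volume.restrict (Set.Ioo 0 1)) =
        Measure.map ξ (volume.restrict (Set.Ioo 0 1)) := by
  have q0 : 0 < 1 - p := sub_pos.2 h1
  obtain ⟨g, gI, gr, gl, gm, gd⟩ := exists_leftBranch h0 h1
  -- By the symmetry of `logBeta`, the right branch at mode `p` is `1 - r`. So `{logBeta p ≤ u}` has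
  -- measure `g u + r u` for `u < M`, and `ξ` is the inverse of this sum.
  obtain ⟨r, rI, rr, rl, rm, rd⟩ := exists_leftBranch q0 (by linarith)
  rw [logBeta_symm] at rI rr rm rd
  set M := logBeta p p with hM
  have maps : Set.MapsTo (fun u => g u + r u) (Set.Iio M) (Set.Ioo 0 1) := by
    intro u hu
    have a := gI hu
    have b := rI hu
    constructor <;> simp only <;> linarith [a.1, a.2, b.1, b.2]
  have hd : ∀ u ∈ Set.Iio M, HasDerivAt (fun u => g u + r u)
      (g u * (1 - g u) / (p - g u) + r u * (1 - r u) / (1 - p - r u)) u :=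
    fun u hu => (gd u hu).add (rd u hu)
  have hpos : ∀ u ∈ Set.Iio M,
      0 < g u * (1 - g u) / (p - g u) + r u * (1 - r u) / (1 - p - r u) := by
    intro u hu
    have a := gI hu
    have b := rI hu
    have a1 := sub_pos.2 a.2
    have b1 := sub_pos.2 b.2
    have a0 := a.1
    have b0 := b.1
    have a2 : 0 < 1 - g u := by linarith
    have b2 : 0 < 1 - r u := by linarith
    positivity
  have mono : StrictMonoOn (fun u => g u + r u) (Set.Iio M) :=
    fun x hx y hy hxy => add_lt_add (gm hx hy hxy) (rm hx hy hxy)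
  have hlev : ∀ ε, 0 < ε → ε < 1 → logBeta p (p * ε) < M ∧ logBeta (1 - p) ((1 - p) * ε) < M := by
    intro ε e0 e1
    constructor
    · exact logBeta_lt_max h0 h1 (by positivity) (by nlinarith) (by nlinarith)
    · rw [hM, ← logBeta_symm p p]
      exact logBeta_lt_max q0 (by linarith) (by positivity) (by nlinarith) (by nlinarith)
  have hgε : ∀ ε, 0 < ε → ε < 1 → g (logBeta p (p * ε)) = p * ε :=
    fun ε e0 e1 => gl _ ⟨by positivity, by nlinarith⟩
  have hrε : ∀ ε, 0 < ε → ε < 1 → r (logBeta (1 - p) ((1 - p) * ε)) = (1 - p) * ε :=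
    fun ε e0 e1 => rl _ ⟨by positivity, by nlinarith⟩
  -- The left piece of length `p * k` and the right piece of length `(1 - p) * k` have total length
  -- `k`, but may end at different levels. At the lower level the sum is at most `k`, at the higher
  -- at least `k`, and the intermediate value theorem applies between them.
  have surj : Set.SurjOn (fun u => g u + r u) (Set.Iio M) (Set.Ioo 0 1) := by
    intro k hk
    obtain ⟨m1, m2⟩ := hlev k hk.1 hk.2
    have e1 := hgε k hk.1 hk.2
    have e2 := hrε k hk.1 hk.2
    set u1 := logBeta p (p * k)
    set u2 := logBeta (1 - p) ((1 - p) * k)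
    have mlo : min u1 u2 < M := min_lt_of_left_lt m1
    have mhi : max u1 u2 < M := max_lt m1 m2
    have lo : g (min u1 u2) + r (min u1 u2) ≤ k := by
      have := gm.monotoneOn (show min u1 u2 ∈ _ from mlo) (show u1 ∈ Set.Iio M from m1)
        (min_le_left _ _)
      have := rm.monotoneOn (show min u1 u2 ∈ _ from mlo) (show u2 ∈ Set.Iio M from m2)
        (min_le_right _ _)
      linarith
    have hi : k ≤ g (max u1 u2) + r (max u1 u2) := by
      have := gm.monotoneOn (show u1 ∈ Set.Iio M from m1) (show max u1 u2 ∈ _ from mhi)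
        (le_max_left _ _)
      have := rm.monotoneOn (show u2 ∈ Set.Iio M from m2) (show max u1 u2 ∈ _ from mhi)
        (le_max_right _ _)
      linarith
    have hc : ContinuousOn (fun u => g u + r u) (Set.Icc (min u1 u2) (max u1 u2)) :=
      fun u hu => (hd u (hu.2.trans_lt mhi)).continuousAt.continuousWithinAt
    obtain ⟨u, hu, rfl⟩ := intermediate_value_Icc min_le_max hc ⟨lo, hi⟩
    exact ⟨u, hu.2.trans_lt mhi, rfl⟩
  obtain ⟨ξ, ξI, ξr, ξl, ξm, ξd⟩ := mono.exists_inverse_hasDerivAt isOpen_Iio isOpen_Ioo maps surj hd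
    fun u hu => (hpos u hu).ne'
  have hlr : ∀ u ∈ Set.Iio M, logBeta p (1 - r u) = u := by
    intro u hu
    rw [← logBeta_symm, sub_sub_cancel, rr u hu]
  have hcont : ContinuousOn ξ (Set.Ioo 0 1) :=
    fun k hk => (ξd k hk).continuousAt.continuousWithinAt
  have haem : AEMeasurable ξ (volume.restrict (Set.Ioo 0 1)) :=
    hcont.aemeasurable measurableSet_Ioo
  refine ⟨ξ, ξm, ?_, fun u hu => ⟨_, maps hu, ξl u hu⟩, ?_⟩
  · intro k hk
    have hu := ξI hk
    have hk' := ξr k hk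
    have hdk := ξd k hk
    have a := gI hu
    have b := rI hu
    refine ⟨g (ξ k), a.1, by linarith [b.1], a.2, by linarith [b.2], gr _ hu, ?_, ?_⟩
    · rw [show g (ξ k) + (1 - k) = 1 - r (ξ k) by linarith]
      exact hlr _ hu
    -- With `s = 1 - r (ξ k)`, the identity `t * (1 - t) - p * (1 - p) = (t - p) * (1 - t - p)`,
    -- used for `t` and for `s`, merges the two branch derivatives into one product of distances to
    -- the mode.
    · convert hdk using 2
      have a1 := sub_pos.2 a.2
      have b1 := sub_pos.2 b.2
      rw [show g (ξ k) + (1 - k) - p = 1 - p - r (ξ k) by linarith,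
        show 1 - k = 1 - g (ξ k) - r (ξ k) by linarith]
      field_simp
      ring
  · have : IsFiniteMeasure (Measure.map (logBeta p) (volume.restrict (Set.Ioo (0:ℝ) 1))) :=
      Measure.isFiniteMeasure_map _ _
    refine Measure.ext_of_Iic _ _ fun u => ?_
    rw [Measure.map_apply (measurable_logBeta p) measurableSet_Iic,
      Measure.map_apply_of_aemeasurable haem measurableSet_Iic,
      Measure.restrict_apply' measurableSet_Ioo, Measure.restrict_apply' measurableSet_Ioo]
    by_cases hu : u < M
    · have hS := maps hu
      have a := gI hu
      have b := rI hu
      have s1 : logBeta p ⁻¹' Set.Iic u ∩ Set.Ioo 0 1 = Set.Ioc 0 (g u) ∪ Set.Ico (1 - r u) 1 := by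
        ext t
        simp only [Set.mem_inter_iff, Set.mem_preimage, Set.mem_Iic, Set.mem_Ioo, Set.mem_union,
          Set.mem_Ioc, Set.mem_Ico]
        constructor
        · rintro ⟨h, t0, t1⟩
          rcases le_total t p with htp | htp
          · left
            rw [← gr u hu, (strictMonoOn_logBeta h1).le_iff_le ⟨t0, htp⟩ ⟨a.1, a.2.le⟩] at h
            exact ⟨t0, h⟩
          · right
            rw [← hlr u hu, (strictAntiOn_logBeta h0).le_iff_ge ⟨htp, t1⟩
              ⟨by linarith [b.2], by linarith [b.1]⟩] at h
            exact ⟨h, t1⟩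
        · rintro (⟨t0, h⟩ | ⟨h, t1⟩)
          · refine ⟨?_, t0, by linarith [a.2]⟩
            rw [← gr u hu, (strictMonoOn_logBeta h1).le_iff_le ⟨t0, by linarith [a.2]⟩
              ⟨a.1, a.2.le⟩]
            exact h
          · refine ⟨?_, by linarith [b.2], t1⟩
            rw [← hlr u hu, (strictAntiOn_logBeta h0).le_iff_ge ⟨by linarith [b.2], t1⟩
              ⟨by linarith [b.2], by linarith [b.1]⟩]
            exact h
      have s2 : ξ ⁻¹' Set.Iic u ∩ Set.Ioo 0 1 = Set.Ioc 0 (g u + r u) := by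
        ext k
        simp only [Set.mem_inter_iff, Set.mem_preimage, Set.mem_Iic, Set.mem_Ioc]
        constructor
        · rintro ⟨h, hk⟩
          refine ⟨hk.1, ?_⟩
          rw [← ξl u hu] at h
          exact (ξm.le_iff_le hk hS).1 h
        · rintro ⟨k0, h⟩
          have hk : k ∈ Set.Ioo (0 : ℝ) 1 := ⟨k0, h.trans_lt hS.2⟩
          refine ⟨?_, hk⟩
          rw [← ξl u hu]
          exact (ξm.le_iff_le hk hS).2 h
      rw [s1, s2, measure_union _ measurableSet_Ico, Real.volume_Ioc, Real.volume_Ioc,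
        Real.volume_Ico, ← ENNReal.ofReal_add (by linarith [a.1]) (by linarith [b.1])]
      · congr 1; ring
      · rw [Set.disjoint_left]
        rintro t ⟨-, h2⟩ ⟨h3, -⟩
        linarith [a.2, b.2]
    -- From the maximal level upwards both sublevel sets are all of `(0, 1)`.
    · push Not at hu
      congr 1
      ext t
      simp only [Set.mem_inter_iff, Set.mem_preimage, Set.mem_Iic, and_congr_left_iff]
      intro ht
      exact ⟨fun _ => (show ξ t < M from ξI ht).le.trans hu,
        fun _ => (logBeta_le_max h0 h1 ht.1 ht.2).trans hu⟩

/-- The increasing rearrangements for `1 / 2 ≤ p < p'` have a strictly increasing difference. -/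
theorem strictMonoOn_rearrangement_sub {p p' : ℝ} {ξ ξ' : ℝ → ℝ} (hp : 1 / 2 ≤ p) (hpp : p < p')
    (h1 : p' < 1)
    (h : ∀ k ∈ Set.Ioo (0 : ℝ) 1, ∃ t, 0 < t ∧ t < k ∧ t < p ∧ p < t + (1 - k) ∧
        logBeta p t = ξ k ∧ logBeta p (t + (1 - k)) = ξ k ∧
        HasDerivAt ξ ((1 - k) *
          ((p - t) * (t + (1 - k) - p) / (p * (1 - p)))⁻¹ - (1 - k))⁻¹ k)
    (h' : ∀ k ∈ Set.Ioo (0 : ℝ) 1, ∃ t, 0 < t ∧ t < k ∧ t < p' ∧ p' < t + (1 - k) ∧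
        logBeta p' t = ξ' k ∧ logBeta p' (t + (1 - k)) = ξ' k ∧
        HasDerivAt ξ' ((1 - k) *
          ((p' - t) * (t + (1 - k) - p') / (p' * (1 - p')))⁻¹ - (1 - k))⁻¹ k) :
    StrictMonoOn (fun k => ξ' k - ξ k) (Set.Ioo 0 1) := by
  refine strictMonoOn_of_deriv_pos (convex_Ioo _ _) (fun k hk => ?_) fun k hk => ?_
  · obtain ⟨_, _, _, _, _, _, _, hd⟩ := h k hk
    obtain ⟨_, _, _, _, _, _, _, hd'⟩ := h' k hk
    exact (hd'.fun_sub hd).continuousAt.continuousWithinAt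
  · rw [interior_Ioo] at hk
    obtain ⟨t, t0, t1, tp, ps, e, e2, hd⟩ := h k hk
    obtain ⟨t', t0', t1', tp', ps', e', e2', hd'⟩ := h' k hk
    rw [(hd'.fun_sub hd).deriv, sub_pos]
    have l0 : 0 < 1 - k := sub_pos.2 hk.2
    have key := chord_product_lt (t := t) (t' := t') l0 (by linarith [hk.1]) hp hpp t0
      (by linarith) t0' (by linarith) (e.trans e2.symm) (e'.trans e2'.symm)
    have p0 : 0 < p := by linarith
    have q0 : 0 < 1 - p := by linarith
    have a1 := sub_pos.2 tp
    have a2 := sub_pos.2 ps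
    have F0 : 0 < (p - t) * (t + (1 - k) - p) / (p * (1 - p)) := by positivity
    -- The distances from the mode to the ends of the chord are smaller than those to `0` and `1`.
    -- This makes `1 / F' - 1` positive, so that reciprocals may be compared.
    have F1 : (p' - t') * (t' + (1 - k) - p') / (p' * (1 - p')) < 1 := by
      rw [div_lt_one (by nlinarith)]
      exact mul_lt_mul'' (by linarith) (by linarith) (by linarith) (by linarith)
    generalize (p - t) * (t + (1 - k) - p) / (p * (1 - p)) = F at *
    generalize (p' - t') * (t' + (1 - k) - p') / (p' * (1 - p')) = F' at *
    have i1 : F'⁻¹ < F⁻¹ := inv_strictAnti₀ F0 key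
    have i2 : 1 < F'⁻¹ := (one_lt_inv₀ (F0.trans key)).2 F1
    exact inv_strictAnti₀ (by nlinarith) (by nlinarith)

/-! ### Deviation of densities on the unit interval from a constant -/

theorem setIntegral_Ioo_lt {f g : ℝ → ℝ} {a b : ℝ} (hab : a < b)
    (hf : IntegrableOn f (Set.Ioo a b)) (hg : IntegrableOn g (Set.Ioo a b))
    (h : ∀ x ∈ Set.Ioo a b, f x < g x) :
    ∫ x in Set.Ioo a b, f x < ∫ x in Set.Ioo a b, g x := by
  rw [← sub_pos, ← integral_sub hg hf, setIntegral_pos_iff_support_of_nonneg_ae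
    ((ae_restrict_mem measurableSet_Ioo).mono fun x hx => (sub_pos.2 (h x hx)).le) (hg.sub hf)]
  have hs : Set.Ioo a b ⊆ Function.support fun x => g x - f x :=
    fun x hx => (sub_pos.2 (h x hx)).ne'
  rw [Set.inter_eq_self_of_subset_right hs, Real.volume_Ioo]
  simpa using hab

theorem setIntegral_Ioo_split {f : ℝ → ℝ} {e : ℝ} (he : e ∈ Set.Ioo (0 : ℝ) 1)
    (hf : IntegrableOn f (Set.Ioo 0 1)) :
    ∫ x in Set.Ioo 0 1, f x = (∫ x in Set.Ioo 0 e, f x) + ∫ x in Set.Ioo e 1, f x := by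
  rw [← integral_Ioc_eq_integral_Ioo (x := 0) (y := e), ← setIntegral_union _ measurableSet_Ioo,
    Set.Ioc_union_Ioo_eq_Ioo he.1.le he.2]
  · exact hf.mono_set fun x hx => ⟨hx.1, hx.2.trans_lt he.2⟩
  · exact hf.mono_set fun x hx => ⟨he.1.trans hx.1, hx.2⟩
  · rw [Set.disjoint_left]
    rintro x hx hy
    exact absurd hx.2 (not_le.2 hy.1)

/-- A density with increasing likelihood ratio has more mass on upper intervals. -/
theorem setIntegral_upper_lt {f g : ℝ → ℝ} {e : ℝ} (he : e ∈ Set.Ioo (0 : ℝ) 1)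
    (hf : IntegrableOn f (Set.Ioo 0 1)) (hg : IntegrableOn g (Set.Ioo 0 1))
    (heq : ∫ x in Set.Ioo 0 1, f x = ∫ x in Set.Ioo 0 1, g x)
    (f0 : ∀ x ∈ Set.Ioo (0 : ℝ) 1, 0 < f x)
    (hr : StrictMonoOn (fun x => g x / f x) (Set.Ioo 0 1)) :
    ∫ x in Set.Ioo 0 e, g x < ∫ x in Set.Ioo 0 e, f x ∧
      ∫ x in Set.Ioo e 1, f x < ∫ x in Set.Ioo e 1, g x := by
  have sl : Set.Ioo 0 e ⊆ Set.Ioo 0 1 := Set.Ioo_subset_Ioo_right he.2.le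
  have su : Set.Ioo e 1 ⊆ Set.Ioo 0 1 := Set.Ioo_subset_Ioo_left he.1.le
  rw [setIntegral_Ioo_split he hf, setIntegral_Ioo_split he hg] at heq
  -- The position of the ratio at `e` relative to `1` decides on which side of `e` the densities
  -- compare pointwise; equality of total masses gives the other side.
  rcases le_total 1 (g e / f e) with h | h
  · have := setIntegral_Ioo_lt he.2 (hf.mono_set su) (hg.mono_set su) fun x hx =>
      (one_lt_div (f0 x (su hx))).1 (h.trans_lt (hr he (su hx) hx.1))
    exact ⟨by linarith, this⟩
  · have := setIntegral_Ioo_lt he.1 (hg.mono_set sl) (hf.mono_set sl) fun x hx =>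
      (div_lt_one (f0 x (sl hx))).1 ((hr (sl hx) he hx.2).trans_le h)
    exact ⟨this, by linarith⟩

/-- Since `f` is monotone, `f - f e` changes sign only at `e`, so its absolute integral is a signed
one on each side. For `g` the same signed integrals are lower bounds, and they are larger because
mass has moved upwards across `e`. Monotonicity of `g` plays no role. -/
theorem integral_abs_sub_lt {f g : ℝ → ℝ} {e : ℝ} (he : e ∈ Set.Ioo (0 : ℝ) 1)
    (hf : IntegrableOn f (Set.Ioo 0 1)) (hg : IntegrableOn g (Set.Ioo 0 1))
    (heq : ∫ x in Set.Ioo 0 1, f x = ∫ x in Set.Ioo 0 1, g x)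
    (f0 : ∀ x ∈ Set.Ioo (0 : ℝ) 1, 0 < f x)
    (hr : StrictMonoOn (fun x => g x / f x) (Set.Ioo 0 1)) (fm : MonotoneOn f (Set.Ioo 0 1)) :
    ∫ x in Set.Ioo 0 1, |f x - f e| < ∫ x in Set.Ioo 0 1, |g x - f e| := by
  have hc : IntegrableOn (fun _ => f e) (Set.Ioo (0 : ℝ) 1) := integrableOn_const (by simp)
  have sl : Set.Ioo 0 e ⊆ Set.Ioo 0 1 := Set.Ioo_subset_Ioo_right he.2.le
  have su : Set.Ioo e 1 ⊆ Set.Ioo 0 1 := Set.Ioo_subset_Ioo_left he.1.le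
  have fa : IntegrableOn (fun x => |f x - f e|) (Set.Ioo 0 1) := (hf.sub hc).abs
  have ga : IntegrableOn (fun x => |g x - f e|) (Set.Ioo 0 1) := (hg.sub hc).abs
  obtain ⟨i1, i2⟩ := setIntegral_upper_lt he hf hg heq f0 hr
  rw [setIntegral_Ioo_split he fa, setIntegral_Ioo_split he ga]
  have a1 : ∫ x in Set.Ioo 0 e, |f x - f e| = ∫ x in Set.Ioo 0 e, (f e - f x) :=
    setIntegral_congr_fun measurableSet_Ioo fun x hx => by
      rw [abs_sub_comm, abs_of_nonneg (sub_nonneg.2 (fm (sl hx) he hx.2.le))]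
  have a2 : ∫ x in Set.Ioo e 1, |f x - f e| = ∫ x in Set.Ioo e 1, (f x - f e) :=
    setIntegral_congr_fun measurableSet_Ioo fun x hx =>
      abs_of_nonneg (sub_nonneg.2 (fm he (su hx) hx.1.le))
  have b1 : ∫ x in Set.Ioo 0 e, (f e - g x) ≤ ∫ x in Set.Ioo 0 e, |g x - f e| :=
    setIntegral_mono ((hc.sub hg).mono_set sl) (ga.mono_set sl) fun x => by
      rw [abs_sub_comm]; exact le_abs_self _
  have b2 : ∫ x in Set.Ioo e 1, (g x - f e) ≤ ∫ x in Set.Ioo e 1, |g x - f e| :=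
    setIntegral_mono ((hg.sub hc).mono_set su) (ga.mono_set su) fun x => le_abs_self _
  rw [integral_sub (hc.mono_set sl) (hf.mono_set sl)] at a1
  rw [integral_sub (hf.mono_set su) (hc.mono_set su)] at a2
  rw [integral_sub (hc.mono_set sl) (hg.mono_set sl)] at b1
  rw [integral_sub (hg.mono_set su) (hc.mono_set su)] at b2
  linarith

theorem integrableOn_exp_logBeta {N p : ℝ} (hN : 0 < N) (h0 : 0 < p) (h1 : p < 1) :
    IntegrableOn (fun t => Real.exp (N * logBeta p t)) (Set.Ioo 0 1) := by
  refine Measure.integrableOn_of_bounded (M := Real.exp (N * logBeta p p)) (by simp)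
    (((measurable_logBeta p).const_mul N).exp.aestronglyMeasurable) ?_
  refine (ae_restrict_mem measurableSet_Ioo).mono fun t ht => ?_
  rw [Real.norm_of_nonneg (Real.exp_pos _).le, Real.exp_le_exp]
  exact mul_le_mul_of_nonneg_left (logBeta_le_max h0 h1 ht.1 ht.2) hN.le

theorem integral_exp_logBeta_pos {N p : ℝ} (hN : 0 < N) (h0 : 0 < p) (h1 : p < 1) :
    0 < ∫ t in Set.Ioo 0 1, Real.exp (N * logBeta p t) := by
  simpa using setIntegral_Ioo_lt one_pos (integrableOn_const (C := (0 : ℝ)) (by simp))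
    (integrableOn_exp_logBeta hN h0 h1) fun x _ => Real.exp_pos _

/-- The maximum of the normalized beta density therefore exceeds `1`, which is what yields
strictness in `certainty_lt_certainty`. -/
theorem integral_exp_logBeta_lt {N p : ℝ} (hN : 0 < N) (h0 : 0 < p) (h1 : p < 1) :
    ∫ t in Set.Ioo 0 1, Real.exp (N * logBeta p t) < Real.exp (N * logBeta p p) := by
  have hint := integrableOn_exp_logBeta hN h0 h1
  have hc : IntegrableOn (fun _ => Real.exp (N * logBeta p p)) (Set.Ioo (0 : ℝ) 1) :=
    integrableOn_const (by simp)
  have hp : p ∈ Set.Ioo (0 : ℝ) 1 := ⟨h0, h1⟩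
  have sl : Set.Ioo 0 p ⊆ Set.Ioo 0 1 := Set.Ioo_subset_Ioo_right h1.le
  have su : Set.Ioo p 1 ⊆ Set.Ioo 0 1 := Set.Ioo_subset_Ioo_left h0.le
  have := setIntegral_Ioo_lt h0 (hint.mono_set sl) (hc.mono_set sl) fun x hx =>
    Real.exp_lt_exp.2 (mul_lt_mul_of_pos_left
      (logBeta_lt_max h0 h1 hx.1 (hx.2.trans h1) hx.2.ne) hN)
  have := setIntegral_Ioo_lt h1 (hint.mono_set su) (hc.mono_set su) fun x hx =>
    Real.exp_lt_exp.2 (mul_lt_mul_of_pos_left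
      (logBeta_lt_max h0 h1 (h0.trans hx.1) hx.2 hx.1.ne') hN)
  have e : ∫ t in Set.Ioo (0 : ℝ) 1, Real.exp (N * logBeta p p) = Real.exp (N * logBeta p p) := by
    simp
  rw [← e, setIntegral_Ioo_split hp hint, setIntegral_Ioo_split hp hc]
  linarith

/-- The integrated deviation of the beta density with mode `p` and weight `N` from a positive
constant increases with `p ≥ 1 / 2`, strictly below the maximum of the larger density. -/
theorem integral_abs_exp_logBeta_sub {N p p' c : ℝ} (hN : 0 < N) (hp : 1 / 2 ≤ p) (hpp : p < p')
    (h1 : p' < 1) (hc : 0 < c) :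
    ((∫ t in Set.Ioo 0 1, |Real.exp (N * logBeta p t) /
        (∫ r in Set.Ioo 0 1, Real.exp (N * logBeta p r)) - c|) ≤
      ∫ t in Set.Ioo 0 1, |Real.exp (N * logBeta p' t) /
        (∫ r in Set.Ioo 0 1, Real.exp (N * logBeta p' r)) - c|) ∧
    (c < Real.exp (N * logBeta p' p') / (∫ r in Set.Ioo 0 1, Real.exp (N * logBeta p' r)) →
    (∫ t in Set.Ioo 0 1, |Real.exp (N * logBeta p t) /
        (∫ r in Set.Ioo 0 1, Real.exp (N * logBeta p r)) - c|) <
      ∫ t in Set.Ioo 0 1, |Real.exp (N * logBeta p' t) /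
        (∫ r in Set.Ioo 0 1, Real.exp (N * logBeta p' r)) - c|) := by
  have p0 : 0 < p := by linarith
  have p1 : p < 1 := by linarith
  have p0' : 0 < p' := by linarith
  have β0 := integral_exp_logBeta_pos hN p0 p1
  have β0' := integral_exp_logBeta_pos hN p0' h1
  have hi := integrableOn_exp_logBeta hN p0 p1
  have hi' := integrableOn_exp_logBeta hN p0' h1
  set β := ∫ r in Set.Ioo 0 1, Real.exp (N * logBeta p r) with hβ
  set β' := ∫ r in Set.Ioo 0 1, Real.exp (N * logBeta p' r) with hβ'
  obtain ⟨ξ, ξm, ξk, ξs, ξe⟩ := exists_logBeta_rearrangement p0 p1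
  obtain ⟨ξ', ξm', ξk', ξs', ξe'⟩ := exists_logBeta_rearrangement p0' h1
  have hsub := strictMonoOn_rearrangement_sub hp hpp h1 ξk ξk'
  -- Equal pushforwards of Lebesgue measure give equal integrals of every continuous function of the
  -- values.
  have transfer : ∀ {q : ℝ} {η : ℝ → ℝ}, StrictMonoOn η (Set.Ioo 0 1) →
      Measure.map (logBeta q) (volume.restrict (Set.Ioo 0 1)) =
        Measure.map η (volume.restrict (Set.Ioo 0 1)) → ∀ Φ : ℝ → ℝ, Continuous Φ →
      (∫ t in Set.Ioo 0 1, Φ (logBeta q t) = ∫ k in Set.Ioo 0 1, Φ (η k)) ∧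
      (IntegrableOn (fun t => Φ (logBeta q t)) (Set.Ioo 0 1) →
        IntegrableOn (fun t => Φ (η t)) (Set.Ioo 0 1)) := by
    intro q η hη he Φ hΦ
    have haem : AEMeasurable η (volume.restrict (Set.Ioo 0 1)) :=
      aemeasurable_restrict_of_monotoneOn measurableSet_Ioo hη.monotoneOn
    have m1 := hΦ.aestronglyMeasurable (μ := Measure.map (logBeta q)
      (volume.restrict (Set.Ioo 0 1)))
    have m2 := hΦ.aestronglyMeasurable (μ := Measure.map η (volume.restrict (Set.Ioo 0 1)))
    refine ⟨?_, fun h => ?_⟩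
    · rw [← integral_map (measurable_logBeta q).aemeasurable m1, he, integral_map haem m2]
    · have := (integrable_map_measure m1 (measurable_logBeta q).aemeasurable).2 h
      rw [he] at this
      exact (integrable_map_measure m2 haem).1 this
  have ce : Continuous fun u => Real.exp (N * u) := by fun_prop
  have cd : ∀ b : ℝ, Continuous fun u => |Real.exp (N * u) / b - c| := fun b => by fun_prop
  rw [(transfer ξm ξe _ (cd β)).1, (transfer ξm' ξe' _ (cd β')).1]
  rw [(transfer ξm ξe _ ce).1] at hβ
  rw [(transfer ξm' ξe' _ ce).1] at hβ'
  have hi := (transfer ξm ξe _ ce).2 hi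
  have hi' := (transfer ξm' ξe' _ ce).2 hi'
  have fI := hi.div_const β
  have gI := hi'.div_const β'
  have fe : ∫ k in Set.Ioo 0 1, Real.exp (N * ξ k) / β = 1 := by
    rw [integral_div, ← hβ, div_self β0.ne']
  have ge : ∫ k in Set.Ioo 0 1, Real.exp (N * ξ' k) / β' = 1 := by
    rw [integral_div, ← hβ', div_self β0'.ne']
  -- The level `log (d * b) / N` is the one at which the normalized density has the value `d`.
  have solve : ∀ {b M : ℝ}, 0 < b → ∀ {d}, 0 < d → d < Real.exp (N * M) / b →
      Real.log (d * b) / N < M ∧ Real.exp (N * (Real.log (d * b) / N)) / b = d := by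
    intro b M hb d hd hM
    have hdb : 0 < d * b := by positivity
    constructor
    · rw [lt_div_iff₀ hb, ← Real.log_lt_iff_lt_exp hdb] at hM
      rw [div_lt_iff₀ hN]; linarith
    · rw [mul_div_cancel₀ _ hN.ne', Real.exp_log hdb, mul_div_cancel_right₀ _ hb.ne']
  -- Either the density for `p` attains `c`, and the cut is placed there, or it never exceeds `c`.
  -- In the latter case its deviation is `c - 1`, the least possible for a probability density, and
  -- it is exceeded once the density for `p'` rises above `c`.
  rcases lt_or_ge c (Real.exp (N * logBeta p p) / β) with hcM | hcM
  · obtain ⟨s1, s2⟩ := solve β0 hc hcM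
    obtain ⟨e, he, hξe⟩ := ξs _ s1
    rw [← hξe] at s2
    have := integral_abs_sub_lt he fI gI (fe.trans ge.symm) (fun x _ => by positivity) ?_ ?_
    · simp only [s2] at this
      exact ⟨this.le, fun _ => this⟩
    · intro x hx y hy hxy
      have e : ∀ k, Real.exp (N * ξ' k) / β' / (Real.exp (N * ξ k) / β) =
          β / β' * Real.exp (N * (ξ' k - ξ k)) := by
        intro k; rw [mul_sub, Real.exp_sub]; field_simp
      simp only [e]
      exact mul_lt_mul_of_pos_left (Real.exp_lt_exp.2 (mul_lt_mul_of_pos_left (hsub hx hy hxy) hN))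
        (by positivity)
    · intro x hx y hy hxy
      have := ξm.monotoneOn hx hy hxy
      simp only
      gcongr
  · have hcI : IntegrableOn (fun _ => c) (Set.Ioo (0 : ℝ) 1) := integrableOn_const (by simp)
    have hcc : ∫ _ in Set.Ioo (0 : ℝ) 1, c = c := by simp
    have e0 : ∫ k in Set.Ioo 0 1, |Real.exp (N * ξ k) / β - c| = c - 1 := by
      have e2 : ∫ k in Set.Ioo 0 1, (c - Real.exp (N * ξ k) / β) = c - 1 := by
        rw [integral_sub hcI fI, hcc, fe]
      rw [← e2]
      refine setIntegral_congr_fun measurableSet_Ioo fun k hk => ?_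
      obtain ⟨t, t0, -, tp, -, ht, -⟩ := ξk k hk
      have : Real.exp (N * ξ k) / β ≤ c := by
        refine le_trans ?_ hcM
        rw [← ht]
        have := logBeta_le_max p0 p1 t0 (tp.trans p1)
        gcongr
      rw [abs_sub_comm, abs_of_nonneg (sub_nonneg.2 this)]
    have e1 : ∫ k in Set.Ioo 0 1, (c - Real.exp (N * ξ' k) / β') = c - 1 := by
      rw [integral_sub hcI gI, hcc, ge]
    have habs : IntegrableOn (fun k => |Real.exp (N * ξ' k) / β' - c|) (Set.Ioo 0 1) :=
      (gI.sub hcI).abs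
    have hle : ∀ k, c - Real.exp (N * ξ' k) / β' ≤ |Real.exp (N * ξ' k) / β' - c| := fun k => by
      rw [abs_sub_comm]; exact le_abs_self _
    have hcg : IntegrableOn (fun k => c - Real.exp (N * ξ' k) / β') (Set.Ioo 0 1) := hcI.sub gI
    rw [e0, ← e1]
    refine ⟨setIntegral_mono hcg habs hle, fun hcM' => ?_⟩
    obtain ⟨s1, s2⟩ := solve β0' hc hcM'
    obtain ⟨e, he, hξe⟩ := ξs' _ s1
    rw [← hξe] at s2
    have sl : Set.Ioo 0 e ⊆ Set.Ioo 0 1 := Set.Ioo_subset_Ioo_right he.2.le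
    have su : Set.Ioo e 1 ⊆ Set.Ioo 0 1 := Set.Ioo_subset_Ioo_left he.1.le
    rw [setIntegral_Ioo_split he hcg, setIntegral_Ioo_split he habs]
    refine add_lt_add_of_le_of_lt
      (setIntegral_mono (hcg.mono_set sl) (habs.mono_set sl) hle)
      (setIntegral_Ioo_lt he.2 (hcg.mono_set su) (habs.mono_set su) fun x hx => ?_)
    have : c < Real.exp (N * ξ' x) / β' := by
      nth_rw 1 [← s2]
      have := ξm' he (su hx) hx.1
      gcongr
    rw [abs_of_pos (sub_pos.2 this)]
    linarith

/-! ### Integration over the simplex in radial coordinates -/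

theorem isCompact_probSimplex : IsCompact probSimplex := by
  have hcl : IsClosed probSimplex := by
    have : probSimplex = {x : ℝ × ℝ | 0 ≤ x.1} ∩ ({x | 0 ≤ x.2} ∩ {x | x.1 + x.2 ≤ 1}) := rfl
    rw [this]
    exact (isClosed_le (by fun_prop) (by fun_prop)).inter
      ((isClosed_le (by fun_prop) (by fun_prop)).inter (isClosed_le (by fun_prop) (by fun_prop)))
  refine (isCompact_Icc (a := ((0 : ℝ), (0 : ℝ))) (b := (1, 1))).of_isClosed_subset hcl ?_
  rintro ⟨x, y⟩ ⟨h1, h2, h3⟩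
  simp only at h1 h2 h3
  exact ⟨⟨h1, h2⟩, ⟨by simp only; linarith, by simp only; linarith⟩⟩

theorem integrableOn_radial {f : ℝ × ℝ → ℝ} (hf : Continuous f) :
    IntegrableOn (fun s => s * ∫ t in Set.Ioo 0 1, f (s * t, s * (1 - t))) (Set.Ioo 0 1) := by
  simp only [← integral_Icc_eq_integral_Ioo]
  have : Continuous fun s => ∫ t in Set.Icc (0 : ℝ) 1, f (s * t, s * (1 - t)) :=
    continuous_parametric_integral_of_continuous (by
      simp only [Function.uncurry_def]; fun_prop) isCompact_Icc
  exact ((continuous_id.mul this).continuousOn.integrableOn_compact isCompact_Icc).mono_set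
    Set.Ioo_subset_Icc_self

/-- Integration over the simplex in the coordinates `s = x + y` and `t = x / (x + y)`. -/
theorem integral_probSimplex {f : ℝ × ℝ → ℝ} (hf : Continuous f) :
    ∫ x in probSimplex, f x =
      ∫ s in Set.Ioo 0 1, s * ∫ t in Set.Ioo 0 1, f (s * t, s * (1 - t)) := by
  have hm : MeasurableSet probSimplex := isCompact_probSimplex.measurableSet
  have hint : Integrable (probSimplex.indicator f) ((volume : Measure ℝ).prod volume) :=
    (integrable_indicator_iff hm).2 (hf.continuousOn.integrableOn_compact isCompact_probSimplex)
  have mp : MeasurePreserving (MeasurableEquiv.shearAddRight ℝ).symm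
      ((volume : Measure ℝ).prod volume) (volume.prod volume) :=
    measurePreserving_prod_neg_add volume volume
  have hint' : Integrable (fun z => probSimplex.indicator f
      ((MeasurableEquiv.shearAddRight ℝ).symm z)) ((volume : Measure ℝ).prod volume) :=
    (mp.integrable_comp_emb (MeasurableEquiv.measurableEmbedding _)).2 hint
  rw [← integral_indicator hm, Measure.volume_eq_prod, ← mp.integral_comp',
    integral_prod_symm _ hint',
    ← integral_indicator measurableSet_Ioo]
  refine integral_congr_ae ?_
  -- The fibers over `s = 0` and `s = 1` meet the closed simplex, whereas the radial integral runs
  -- over the open interval; they form a null set.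
  have h0 : ∀ᵐ s : ℝ, s ≠ 0 := by simp [ae_iff]
  have h1 : ∀ᵐ s : ℝ, s ≠ 1 := by simp [ae_iff]
  filter_upwards [h0, h1] with s s0 s1
  have hsh : ∀ x, (MeasurableEquiv.shearAddRight ℝ).symm (x, s) = (x, s - x) := fun x => by
    rw [sub_eq_neg_add]; rfl
  simp only [hsh]
  by_cases hs : s ∈ Set.Ioo (0 : ℝ) 1
  · rw [Set.indicator_of_mem hs]
    have e : (fun x => probSimplex.indicator f (x, s - x)) =
        (Set.Icc 0 s).indicator fun x => f (x, s - x) := by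
      ext x
      simp only [Set.indicator_apply, probSimplex, Set.mem_ofPred_eq, Set.mem_Icc, add_sub_cancel,
        sub_nonneg, hs.2.le, and_true]
    rw [e, integral_indicator measurableSet_Icc, integral_Icc_eq_integral_Ioc,
      ← integral_Ioc_eq_integral_Ioo, ← intervalIntegral.integral_of_le hs.1.le,
      ← intervalIntegral.integral_of_le zero_le_one]
    -- The substitution `x = s * t` on the fiber supplies the Jacobian factor `s`.
    have := intervalIntegral.smul_integral_comp_mul_left (a := 0) (b := 1)
      (fun x => f (x, s - x)) s
    rw [mul_zero, mul_one, smul_eq_mul] at this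
    rw [← this]
    simp only [mul_sub, mul_one]
  · rw [Set.indicator_of_notMem hs]
    have e : ∀ x, probSimplex.indicator f (x, s - x) = 0 := by
      intro x
      refine Set.indicator_of_notMem ?_ _
      rintro ⟨a, b, c⟩
      simp only at a b c
      exact hs ⟨lt_of_le_of_ne (by linarith) s0.symm, lt_of_le_of_ne (by linarith) s1⟩
    simp only [e, integral_zero]

theorem integral_id_Ioo : ∫ s in Set.Ioo (0 : ℝ) 1, s = 1 / 2 := by
  rw [← integral_Ioc_eq_integral_Ioo, ← intervalIntegral.integral_of_le zero_le_one, integral_id]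
  norm_num

theorem volume_probSimplex : volume probSimplex = ENNReal.ofReal (1 / 2) := by
  have h := integral_probSimplex (f := fun _ => 1) continuous_const
  simp only [integral_const, smul_eq_mul, mul_one] at h
  simp only [Measure.real, Measure.restrict_apply MeasurableSet.univ, Set.univ_inter,
    Real.volume_Ioo, sub_zero, ENNReal.ofReal_one, ENNReal.toReal_one, mul_one,
    integral_id_Ioo] at h
  rw [← h, ENNReal.ofReal_toReal isCompact_probSimplex.measure_ne_top]

theorem continuous_likelihoodKernel {a b u : ℝ} (ha : 0 < a) (hb : 0 < b) (hu : 0 < u) :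
    Continuous (likelihoodKernel a b u) :=
  (((Real.continuous_rpow_const ha.le).comp continuous_fst).mul
    ((Real.continuous_rpow_const hb.le).comp continuous_snd)).mul
    ((Real.continuous_rpow_const hu.le).comp
      ((continuous_const.sub continuous_fst).sub continuous_snd))

theorem likelihoodKernel_radial {a b u s t : ℝ} (hN : 0 < a + b) (hs : s ∈ Set.Ioo (0 : ℝ) 1)
    (ht : t ∈ Set.Ioo (0 : ℝ) 1) :
    likelihoodKernel a b u (s * t, s * (1 - t)) =
      s ^ (a + b) * (1 - s) ^ u * Real.exp ((a + b) * logBeta (a / (a + b)) t) := by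
  have t1 : 0 < 1 - t := sub_pos.2 ht.2
  have e : (a + b) * logBeta (a / (a + b)) t = Real.log t * a + Real.log (1 - t) * b := by
    unfold logBeta; field_simp; ring
  rw [e, Real.exp_add, ← Real.rpow_def_of_pos ht.1, ← Real.rpow_def_of_pos t1,
    Real.rpow_add hs.1]
  simp only [likelihoodKernel]
  rw [Real.mul_rpow hs.1.le ht.1.le, Real.mul_rpow hs.1.le t1.le,
    show 1 - s * t - s * (1 - t) = 1 - s by ring]
  ring

/-! ### The certainty as a function of the majority share -/

theorem certainty_swap {μ : Measure (ℝ × ℝ)} {κ : ℝ}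
    (hμ : μ = ENNReal.ofReal κ • volume.restrict probSimplex) (a b u : ℝ) :
    certainty μ a b u = certainty μ b a u := by
  have mp : MeasurePreserving (MeasurableEquiv.prodComm (α := ℝ) (β := ℝ)) μ μ := by
    have h : MeasurePreserving (MeasurableEquiv.prodComm (α := ℝ) (β := ℝ)) volume volume :=
      Measure.measurePreserving_swap
    have h2 := h.restrict_preimage_emb (MeasurableEquiv.measurableEmbedding _) probSimplex
    have e : MeasurableEquiv.prodComm (α := ℝ) (β := ℝ) ⁻¹' probSimplex = probSimplex := by
      ext ⟨x, y⟩
      change (0 ≤ y ∧ 0 ≤ x ∧ y + x ≤ 1) ↔ (0 ≤ x ∧ 0 ≤ y ∧ x + y ≤ 1)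
      rw [add_comm]; tauto
    rw [e] at h2
    rw [hμ]
    exact h2.smul_measure _
  have hl : ∀ x, likelihoodKernel a b u (MeasurableEquiv.prodComm x) =
      likelihoodKernel b a u x := by
    intro x
    change x.2 ^ a * x.1 ^ b * (1 - x.2 - x.1) ^ u = x.1 ^ b * x.2 ^ a * (1 - x.1 - x.2) ^ u
    rw [sub_right_comm]; ring
  unfold certainty posteriorDensity priorDensity
  rw [← mp.integral_comp' (fun y => 1 * likelihoodKernel a b u y),
    ← mp.integral_comp' (fun x => |1 * likelihoodKernel a b u x / _ - 1|)]
  simp only [hl]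

/-- The certainty as an iterated integral, over the total `s` and the share `t`. -/
theorem certainty_eq {μ : Measure (ℝ × ℝ)} {κ : ℝ} (hκ : 0 < κ)
    (hμ : μ = ENNReal.ofReal κ • volume.restrict probSimplex) {a b u : ℝ} (ha : 0 < a) (hb : 0 < b)
    (hu : 0 < u) :
    certainty μ a b u = 1 / 2 * ∫ s in Set.Ioo 0 1, s * ∫ t in Set.Ioo 0 1,
      |s ^ (a + b) * (1 - s) ^ u / (∫ r in Set.Ioo 0 1, r * (r ^ (a + b) * (1 - r) ^ u)) *
        (Real.exp ((a + b) * logBeta (a / (a + b)) t) /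
          ∫ r in Set.Ioo 0 1, Real.exp ((a + b) * logBeta (a / (a + b)) r)) - κ| ∧
    IntegrableOn (fun s => s * ∫ t in Set.Ioo 0 1,
      |s ^ (a + b) * (1 - s) ^ u / (∫ r in Set.Ioo 0 1, r * (r ^ (a + b) * (1 - r) ^ u)) *
        (Real.exp ((a + b) * logBeta (a / (a + b)) t) /
          ∫ r in Set.Ioo 0 1, Real.exp ((a + b) * logBeta (a / (a + b)) r)) - κ|)
      (Set.Ioo 0 1) := by
  have hN : 0 < a + b := by positivity
  have hc := continuous_likelihoodKernel ha hb hu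
  have hμi : ∀ f : ℝ × ℝ → ℝ, ∫ x, f x ∂μ = κ * ∫ x in probSimplex, f x := by
    intro f
    rw [hμ, integral_smul_measure, ENNReal.toReal_ofReal hκ.le, smul_eq_mul]
  set β := ∫ r in Set.Ioo 0 1, Real.exp ((a + b) * logBeta (a / (a + b)) r) with hβ
  set W := ∫ r in Set.Ioo (0 : ℝ) 1, r * (r ^ (a + b) * (1 - r) ^ u) with hW
  have hZ : ∫ x, likelihoodKernel a b u x ∂μ = κ * (W * β) := by
    rw [hμi, integral_probSimplex hc, hW, ← integral_mul_const]
    congr 1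
    refine setIntegral_congr_fun measurableSet_Ioo fun s hs => ?_
    rw [setIntegral_congr_fun measurableSet_Ioo fun t ht => likelihoodKernel_radial hN hs ht,
      integral_const_mul]
    ring
  -- The posterior density is the kernel divided by `κ * (W * β)`. The factor `κ` contributed by
  -- `μ`, moved inside the absolute value, cancels that `κ` and turns the prior `1` into `κ`.
  set F : ℝ × ℝ → ℝ := fun x => |likelihoodKernel a b u x / (W * β) - κ| with hF
  have hFc : Continuous F := ((hc.div_const _).sub continuous_const).abs
  have hrad : Set.EqOn (fun s => s * ∫ t in Set.Ioo 0 1, F (s * t, s * (1 - t)))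
      (fun s => s * ∫ t in Set.Ioo 0 1, |s ^ (a + b) * (1 - s) ^ u / W *
        (Real.exp ((a + b) * logBeta (a / (a + b)) t) / β) - κ|) (Set.Ioo 0 1) := by
    intro s hs
    simp only
    congr 1
    refine setIntegral_congr_fun measurableSet_Ioo fun t ht => ?_
    simp only [hF]
    rw [likelihoodKernel_radial hN hs ht, mul_div_mul_comm]
  refine ⟨?_, (integrableOn_congr_fun hrad measurableSet_Ioo).1 (integrableOn_radial hFc)⟩
  rw [← setIntegral_congr_fun measurableSet_Ioo hrad, ← integral_probSimplex hFc]
  unfold certainty posteriorDensity priorDensity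
  simp only [one_mul, hZ]
  rw [hμi, ← integral_const_mul]
  congr 1
  refine integral_congr_ae (Filter.Eventually.of_forall fun x => ?_)
  simp only [hF]
  nth_rw 1 [← abs_of_pos hκ]
  rw [← abs_mul, mul_sub, mul_one]
  congr 2
  field_simp

/-- The certainty increases with the share of the majority. -/
theorem certainty_lt_certainty {μ : Measure (ℝ × ℝ)} {κ : ℝ} (hκ : 0 < κ) (hκ2 : κ ≤ 2)
    (hμ : μ = ENNReal.ofReal κ • volume.restrict probSimplex) {a a' N u : ℝ} (hN : 0 < N)
    (ha : N / 2 ≤ a) (haa : a < a') (ha' : a' < N) (hu : 0 < u) :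
    certainty μ a (N - a) u < certainty μ a' (N - a') u := by
  obtain ⟨e, hi⟩ := certainty_eq hκ hμ (a := a) (b := N - a) (by linarith) (by linarith) hu
  obtain ⟨e', hi'⟩ := certainty_eq hκ hμ (a := a') (b := N - a') (by linarith) (by linarith) hu
  simp only [add_sub_cancel] at e e' hi hi'
  rw [e, e']
  have hp : 1 / 2 ≤ a / N := by rw [le_div_iff₀ hN]; linarith
  have hpp : a / N < a' / N := by gcongr
  have h1 : a' / N < 1 := (div_lt_one hN).2 ha'
  have h0' : 0 < a' / N := by linarith
  have key := fun {c : ℝ} => integral_abs_exp_logBeta_sub (c := c) hN hp hpp h1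
  have hmax := integral_exp_logBeta_lt hN h0' h1
  have β0' := integral_exp_logBeta_pos hN h0' h1
  set β := ∫ r in Set.Ioo 0 1, Real.exp (N * logBeta (a / N) r)
  set β' := ∫ r in Set.Ioo 0 1, Real.exp (N * logBeta (a' / N) r)
  set w : ℝ → ℝ := fun s => s ^ N * (1 - s) ^ u with hw
  have w0 : ∀ s ∈ Set.Ioo (0 : ℝ) 1, 0 < w s := fun s hs =>
    mul_pos (Real.rpow_pos_of_pos hs.1 _) (Real.rpow_pos_of_pos (sub_pos.2 hs.2) _)
  have wc : Continuous w := (Real.continuous_rpow_const hN.le).mul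
    ((Real.continuous_rpow_const hu.le).comp (continuous_const.sub continuous_id))
  have wi : IntegrableOn (fun s => s * w s) (Set.Ioo 0 1) :=
    ((continuous_id.mul wc).continuousOn.integrableOn_compact isCompact_Icc).mono_set
      Set.Ioo_subset_Icc_self
  have W0 : 0 < ∫ s in Set.Ioo 0 1, s * w s := by
    simpa using setIntegral_Ioo_lt one_pos (integrableOn_const (C := (0 : ℝ)) (by simp)) wi
      fun s hs => mul_pos hs.1 (w0 s hs)
  set W := ∫ s in Set.Ioo 0 1, s * w s with hW
  set D : ℝ := Real.exp (N * logBeta (a' / N) (a' / N)) / β' with hD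
  have D1 : 1 < D := (one_lt_div β0').2 hmax
  set J : ℝ → ℝ := fun s => s * ∫ t in Set.Ioo 0 1,
    |s ^ N * (1 - s) ^ u / W * (Real.exp (N * logBeta (a / N) t) / β) - κ| with hJ
  set J' : ℝ → ℝ := fun s => s * ∫ t in Set.Ioo 0 1,
    |s ^ N * (1 - s) ^ u / W * (Real.exp (N * logBeta (a' / N) t) / β') - κ| with hJ'
  -- Dividing by the radial density `w s / W` reduces each fiber to the deviation of a beta density
  -- from the constant `κ / (w s / W)`.
  have scale : ∀ s ∈ Set.Ioo (0 : ℝ) 1, ∀ g : ℝ → ℝ,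
      s * ∫ t in Set.Ioo 0 1, |s ^ N * (1 - s) ^ u / W * g t - κ| =
        s * (w s / W) * ∫ t in Set.Ioo 0 1, |g t - κ / (w s / W)| := by
    intro s hs g
    have h0 : 0 < w s / W := div_pos (w0 s hs) W0
    rw [mul_assoc, ← integral_const_mul (w s / W)]
    refine congrArg (s * ·) (setIntegral_congr_fun measurableSet_Ioo fun t _ => ?_)
    nth_rw 2 [← abs_of_pos h0]
    rw [← abs_mul, mul_sub, mul_div_cancel₀ _ h0.ne']
  have hle : ∀ s ∈ Set.Ioo (0 : ℝ) 1, J s ≤ J' s ∧ (κ < w s / W * D → J s < J' s) := by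
    intro s hs
    have h0 : 0 < w s / W := div_pos (w0 s hs) W0
    have hs0 : 0 < s * (w s / W) := mul_pos hs.1 h0
    obtain ⟨k1, k2⟩ := key (c := κ / (w s / W)) (by positivity)
    simp only [hJ, hJ', scale s hs]
    refine ⟨mul_le_mul_of_nonneg_left k1 hs0.le, fun h => mul_lt_mul_of_pos_left (k2 ?_) hs0⟩
    rwa [div_lt_iff₀' h0]
  have hmono : ∫ s in Set.Ioo 0 1, J s ≤ ∫ s in Set.Ioo 0 1, J' s :=
    setIntegral_mono_on hi hi' measurableSet_Ioo fun s hs => (hle s hs).1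
  -- Equality would force `w s / W * D ≤ κ` for almost every `s`, as the fiber comparison is strict
  -- wherever this fails. Integrating against `s ds` gives `D ≤ κ / 2 ≤ 1`, contrary to `1 < D`;
  -- here `κ ≤ 2`, the reciprocal of the area of the simplex, is essential.
  refine mul_lt_mul_of_pos_left (lt_of_le_of_ne hmono fun heq => ?_) (by norm_num)
  have hz : ∫ s in Set.Ioo 0 1, (J' s - J s) = 0 := by
    rw [integral_sub hi' hi, heq, sub_self]
  rw [setIntegral_eq_zero_iff_of_nonneg_ae ((ae_restrict_mem measurableSet_Ioo).mono fun s hs =>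
    sub_nonneg.2 (hle s hs).1) (hi'.sub hi)] at hz
  have hbound : ∀ᵐ s ∂volume.restrict (Set.Ioo (0 : ℝ) 1), s * w s * (D / W) ≤ s * κ := by
    filter_upwards [hz, ae_restrict_mem measurableSet_Ioo] with s h hs
    simp only [Pi.zero_apply] at h
    have : w s / W * D ≤ κ := by
      by_contra! hc
      linarith [(hle s hs).2 hc]
    calc s * w s * (D / W) = s * (w s / W * D) := by ring
      _ ≤ s * κ := mul_le_mul_of_nonneg_left this hs.1.le
  have hid : IntegrableOn (fun s : ℝ => s * κ) (Set.Ioo 0 1) :=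
    ((continuous_id.mul continuous_const).continuousOn.integrableOn_compact isCompact_Icc).mono_set
      Set.Ioo_subset_Icc_self
  have := integral_mono_ae (wi.mul_const (D / W)) hid hbound
  rw [integral_mul_const, integral_mul_const, integral_id_Ioo, ← hW, mul_div_cancel₀ _ W0.ne'] at this
  linarith

theorem conflict_lt_conflict_half {a b N : ℝ} (ha : 0 < a) (hb : 0 < b) (hN : a + b = N)
    (hab : a ≠ b) : conflict a b < conflict (N / 2) (N / 2) := by
  have h0 : 0 < a + b := by positivity
  have e : conflict (N / 2) (N / 2) = 1 / 2 := by
    rw [conflict, min_self, ← hN]; field_simp; norm_num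
  rw [e, conflict]
  rcases hab.lt_or_gt with h | h
  · exact min_lt_of_left_lt (by rw [div_lt_iff₀ h0]; linarith)
  · exact min_lt_of_right_lt (by rw [div_lt_iff₀ h0]; linarith)

theorem theorem2 (μ : MeasureTheory.Measure (ℝ × ℝ))
    (hμ : μ = areaElement ∨ μ = uniformElement)
    (nU : ℝ) (hnU : 0 < nU) (N : ℝ) (hN : 0 < N) :
    StrictAntiOn (fun nAB : ℝ => certainty μ nAB (N - nAB) nU)
        {nAB : ℝ | 0 < nAB ∧ 0 < N - nAB ∧ nAB ≤ N - nAB} ∧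
      StrictMonoOn (fun nAB : ℝ => certainty μ nAB (N - nAB) nU)
        {nAB : ℝ | 0 < nAB ∧ 0 < N - nAB ∧ N - nAB ≤ nAB} ∧
      ∀ nAB nBA : ℝ, 0 < nAB → 0 < nBA → nAB + nBA = N → nAB ≠ nBA →
        conflict nAB nBA < conflict (N / 2) (N / 2) ∧
          certainty μ (N / 2) (N / 2) nU < certainty μ nAB nBA nU := by
  obtain ⟨κ, hκ, hκ2, hμ⟩ : ∃ κ : ℝ, 0 < κ ∧ κ ≤ 2 ∧
      μ = ENNReal.ofReal κ • volume.restrict probSimplex := by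
    rcases hμ with rfl | rfl
    · exact ⟨1, one_pos, one_le_two, by rw [ENNReal.ofReal_one, one_smul, areaElement]⟩
    · refine ⟨2, two_pos, le_rfl, ?_⟩
      rw [uniformElement, ProbabilityTheory.cond, volume_probSimplex,
        ← ENNReal.ofReal_inv_of_pos (by norm_num)]
      norm_num
  have mono : StrictMonoOn (fun nAB : ℝ => certainty μ nAB (N - nAB) nU)
      {nAB : ℝ | 0 < nAB ∧ 0 < N - nAB ∧ N - nAB ≤ nAB} := fun x hx y hy hxy =>
    certainty_lt_certainty hκ hκ2 hμ hN (by linarith [hx.2.2]) hxy (by linarith [hy.2.1]) hnU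
  have anti : StrictAntiOn (fun nAB : ℝ => certainty μ nAB (N - nAB) nU)
      {nAB : ℝ | 0 < nAB ∧ 0 < N - nAB ∧ nAB ≤ N - nAB} := by
    intro x ⟨x0, x1, x2⟩ y ⟨y0, y1, y2⟩ hxy
    -- Exchanging the two coordinates reflects the minority range onto the majority range and
    -- reverses the order.
    have := mono (a := N - y) (b := N - x) ⟨y1, by linarith, by linarith⟩
      ⟨x1, by linarith, by linarith⟩ (by linarith)
    simp only [sub_sub_cancel] at this
    simp only
    rwa [certainty_swap hμ x, certainty_swap hμ y]
  refine ⟨anti, mono, fun a b ha hb hab hne => ⟨conflict_lt_conflict_half ha hb hab hne, ?_⟩⟩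
  have eb : b = N - a := by linarith
  have eh : certainty μ (N / 2) (N / 2) nU = certainty μ (N / 2) (N - N / 2) nU := by
    rw [sub_half]
  rw [eh, eb]
  rw [eb] at hne hb
  rcases hne.lt_or_gt with h | h
  · exact anti ⟨ha, hb, h.le⟩ ⟨by linarith, by linarith, by linarith⟩ (by linarith)
  · exact mono ⟨by linarith, by linarith, by linarith⟩ ⟨ha, hb, h.le⟩ (by linarith)
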